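/- Consider a rigid body with principal moments of inertia $0<I_3<I_1<I_2$ carrying a rotor with constant internal angular momentum $A=(0,h,0)$, $h>0$. Its angular momentum $L=(L_1,L_2,L_3)$ in the body frame satisfies, with rotor on, $$\dot L=L\times\Omega,\qquad \Omega=I^{-1}(L-A),\qquad I=\mathrm{diag}(I_1,I_2,I_3).$$ Let $l>0$ and put $$\delta=\frac{I_1}{I_2}-1,\quad \gamma=\frac{I_1}{I_3}-1,\quad \nu=\frac{\delta}{\gamma},\quad \rho=\frac hl,\quad \hat\rho=\rho(1+\delta),$$ and let $E=\frac{I_1}{l^2}\cdot\frac12 (L-A)^tI^{-1}(L-A)$ be the dimensionless energy. Let $L(t)$, $t\in\mathbb R$, be the solution with $L(0)=(l,0,0)$. Then: 1. The energy along this orbit is $E_2=\frac12(1+\rho\hat\rho)$. 2. The tilt $\theta$, defined by $L_3=l\sin\theta$, has on this orbit a maximum $\theta_{max}\in(0,\pi/2)$. It is attained exactly at the point $L=l\,(0,-\sin\tilde\theta_{max},\cos\tilde\theta_{max})$ with $\tilde\theta_{max}\in(-\pi/2,0)$, where, with $s_+=\sin\theta_{max}$, $$-\sqrt{1-s_+^2}=-\cos\theta_{max}=\sin\tilde\theta_{max}=\frac{\hat\rho-\sqrt{\hat\rho^2+\gamma(\gamma-\delta)}}{\gamma-\delta}.$$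 3. There is a number $s_-\in(0,1)$ with $s_-^2=s_+^2+(1-s_+^2)\nu$. Let $T_2>0$ be the time needed to run through the orbit segment, inside the octant $L_1,L_2,L_3>0$, that joins $(l,0,0)$ and the highest point. (For $h>0$ the flow runs through this segment from the highest point to $(l,0,0)$. By the reversing symmetry $(t,L_3)\mapsto(-t,-L_3)$, $T_2$ is also the time in which $L$ moves from $(l,0,0)$ to the mirror image $l\,(0,-\sin\tilde\theta_{max},-\cos\tilde\theta_{max})$, through $L_1,L_2>0>L_3$.) Then $\hat T_2=lT_2/I_1$ satisfies $$\gamma\hat T_2=\frac{2k}{\sqrt{s_-^2(1-\nu)+\nu}}\,K(k^2),\qquad k^2=\frac{(s_-^{-2}-1)\,(s_-^2(1-\nu)+\nu)}{(2-s_-^2)(1-\nu)}<1,$$ where $K(m)=\int_0^{\pi/2}\frac{dx}{\sqrt{1-m\sin^2x}}$. If $s_-^2(1-\nu)+\nu>0$, then $0<k<1$. If $s_-^2(1-\nu)+\nu\le 0$, then $k^2\le 0$ and the quotient $k/\sqrt{s_-^2(1-\nu)+\nu}$ is read as $\sqrt{\frac{1-s_-^2}{s_-^2(2-s_-^2)(1-\nu)}}$,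 which is its value in the first case. -/

import Mathlib

open scoped Matrix

/-- Data of a rigid body (principal moments of inertia `I₁, I₂, I₃`) with total angular momentum
of length `l`, carrying a rotor about the second body axis with internal angular momentum `h`. -/
structure RotorBody where
  I₁ : ℝ
  I₂ : ℝ
  I₃ : ℝ
  l : ℝ
  h : ℝ

namespace RotorBody

noncomputable section

/-- `δ = I₁ / I₂ - 1`. -/
def delta (B : RotorBody) : ℝ := B.I₁ / B.I₂ - 1

/-- `γ = I₁ / I₃ - 1`. -/
def gamma (B : RotorBody) : ℝ := B.I₁ / B.I₃ - 1

/-- `ρ = h / l`. -/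
def rho (B : RotorBody) : ℝ := B.h / B.l

/-- `ρ̂ = ρ (1 + δ)`. -/
def rhoHat (B : RotorBody) : ℝ := B.rho * (1 + B.delta)

/-- `ν = δ / γ`. -/
def nu (B : RotorBody) : ℝ := B.delta / B.gamma

/-- Angular velocity `Ω = I⁻¹ (L - A)` with rotor on, where `I = diag (I₁, I₂, I₃)` and
`A = (0, h, 0)`. -/
def angularVelocity (B : RotorBody) (L : Fin 3 → ℝ) : Fin 3 → ℝ :=
  ![L 0 / B.I₁, (L 1 - B.h) / B.I₂, L 2 / B.I₃]

/-- `L : ℝ → ℝ³` solves the rotor-on Euler equations `dL/dt = L × Ω` for the angular momentum in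
the body frame. -/
def IsRotorOnMotion (B : RotorBody) (L : ℝ → Fin 3 → ℝ) : Prop :=
  ∀ t, HasDerivAt L (L t ⨯₃ B.angularVelocity (L t)) t

/-- The rotor-on energy `½ (L - A)ᵗ I⁻¹ (L - A)`, made dimensionless by division by `l² / I₁`. -/
def energy (B : RotorBody) (L : Fin 3 → ℝ) : ℝ :=
  B.I₁ / B.l ^ 2 *
    (1 / 2 * ((L - ![0, B.h, 0]) ⬝ᵥ
      (Matrix.diagonal ![B.I₁, B.I₂, B.I₃])⁻¹ *ᵥ (L - ![0, B.h, 0])))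

end

end RotorBody

/-- Legendre's complete elliptic integral of the first kind, as a function of the parameter
`m = k²`. -/
noncomputable def ellipticK (m : ℝ) : ℝ :=
  ∫ x in (0 : ℝ)..(Real.pi / 2), 1 / Real.sqrt (1 - m * Real.sin x ^ 2)

/-- The parameter `k²` of the rotor-on time, as a function of `s = s₋` and `ν`. -/
noncomputable def kSquared (s ν : ℝ) : ℝ :=
  ((s ^ 2)⁻¹ - 1) * (s ^ 2 * (1 - ν) + ν) / ((2 - s ^ 2) * (1 - ν))

/-!
The motion through `(l, 0, 0)` is solved explicitly by Jacobi's elliptic functions, and every claim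
is read off the solution.

Write `L = l x`, `γ = I₁ / I₃ - 1`, `δ = I₁ / I₂ - 1`, `ρ̂ = (h / l) (1 + δ)`. Conservation of
the norm and of the energy gives
`γ x₂² = x₁ (2 ρ̂ - δ x₁)` and `γ x₀² = γ - 2 ρ̂ x₁ - (γ - δ) x₁²` (coordinates counted from `0`).
Let `c > 0` and `-β < 0` be the roots of the second quadratic. Then `c < β`, `c < 1`, `c β < 1`
(`exists_orbit_parameters`), and `γ`, `δ`, `ρ̂` are, up to the common factor `γ - δ`, equal to
`c β`, `c β - 1`, `(β - c) / 2`. The coordinate `x₁` oscillates between `0` and `c`. The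
Möbius map `y ↦ y (β + c) / (c (y + β))` sends `0, c, -β` to `0, 1, ∞`; putting its value equal to
`sin² φ` makes `x₁` a rational function of `sin φ` and `cos φ`, and turns the equation for `x₁`
into `φ' = κ √(1 - m sin² φ)` with `m = c² (β² - 1) / (β² - c²)` and
`κ = l (γ - δ) √(β² - c²) / (2 I₁)`. The resulting curve is `rotorOrbit`.

Conversely, with `φ t = am (κ t)` for the Jacobi amplitude `am` (`exists_jacobi_amplitude`), the
curve `l • rotorOrbit c β (φ t)` solves the Euler equations (`isRotorOnMotion_rotorOrbit`), so
uniqueness for `C¹` vector fields (`eq_of_hasDerivAt_of_contDiff`) identifies it with the given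
motion. The highest point is reached at `φ = -π / 2` and its mirror image at `φ = π / 2`, whence
`T₂ = K(m) / κ`. Finally `s₋² = 1 - c / β` and `1 - ν = 1 / (c β)`, which rewrites `m` and `κ` in
the stated form (`kSquared_eq_orbitModulus`, `sqrt_timeFactor_eq`).
-/

open Real Set Filter Topology

/-! ### The incomplete elliptic integral and its inverse -/

/-- Legendre's incomplete elliptic integral of the first kind, with parameter `m = k²`. -/
noncomputable def ellipticF (m φ : ℝ) : ℝ :=
  ∫ x in (0 : ℝ)..φ, 1 / √(1 - m * sin x ^ 2)

theorem one_sub_mul_sin_sq_pos {m : ℝ} (hm : m < 1) (x : ℝ) : 0 < 1 - m * sin x ^ 2 := by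
  rcases (sq_nonneg (sin x)).eq_or_lt with h | h
  · simp [← h]
  · nlinarith [sin_sq_le_one x]

theorem ellipticF_integrand_continuous {m : ℝ} (hm : m < 1) :
    Continuous fun x => 1 / √(1 - m * sin x ^ 2) :=
  continuous_const.div (by fun_prop) fun x => (sqrt_pos.2 (one_sub_mul_sin_sq_pos hm x)).ne'

theorem hasDerivAt_ellipticF {m : ℝ} (hm : m < 1) (φ : ℝ) :
    HasDerivAt (ellipticF m) (√(1 - m * sin φ ^ 2))⁻¹ φ := by
  rw [← one_div]
  exact ((ellipticF_integrand_continuous hm).integral_hasStrictDerivAt 0 φ).hasDerivAt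

theorem ellipticF_strictMono {m : ℝ} (hm : m < 1) : StrictMono (ellipticF m) :=
  strictMono_of_hasDerivAt_pos (hasDerivAt_ellipticF hm) fun φ =>
    inv_pos.2 (sqrt_pos.2 (one_sub_mul_sin_sq_pos hm φ))

theorem ellipticF_surjective {m : ℝ} (hm : m < 1) : Function.Surjective (ellipticF m) := by
  have hper : Function.Periodic (fun x => 1 / √(1 - m * sin x ^ 2)) π := fun x => by
    simp [sin_add_pi]
  have hint := (ellipticF_integrand_continuous hm).intervalIntegrable
    (μ := MeasureTheory.volume) 0 π
  have hpos : ∀ x, 0 < 1 / √(1 - m * sin x ^ 2) := fun x =>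
    one_div_pos.2 (sqrt_pos.2 (one_sub_mul_sin_sq_pos hm x))
  exact Continuous.surjective
    (continuous_iff_continuousAt.2 fun φ => (hasDerivAt_ellipticF hm φ).continuousAt)
    (hper.tendsto_atTop_intervalIntegral_of_pos' hint hpos pi_pos)
    (hper.tendsto_atBot_intervalIntegral_of_pos' hint hpos pi_pos)

theorem ellipticF_neg (m φ : ℝ) : ellipticF m (-φ) = -ellipticF m φ := by
  have h := intervalIntegral.integral_comp_neg (a := 0) (b := φ)
    (fun x => 1 / √(1 - m * sin x ^ 2))
  simp only [sin_neg, neg_sq, neg_zero] at h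
  rw [ellipticF, ellipticF, h, intervalIntegral.integral_symm]

theorem ellipticK_pos {m : ℝ} (hm : m < 1) : 0 < ellipticK m := by
  simpa [ellipticF, ellipticK] using ellipticF_strictMono hm pi_div_two_pos

/-- Jacobi's amplitude function: the inverse of the incomplete elliptic integral. -/
theorem exists_jacobi_amplitude {m : ℝ} (hm : m < 1) :
    ∃ am : ℝ → ℝ, (∀ u, HasDerivAt am (√(1 - m * sin (am u) ^ 2)) u) ∧ StrictMono am ∧
      am 0 = 0 ∧ am (ellipticK m) = π / 2 ∧ am (-ellipticK m) = -(π / 2) := by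
  let e := (ellipticF_strictMono hm).orderIsoOfSurjective _ (ellipticF_surjective hm)
  have hsymm : ∀ φ, e.symm (ellipticF m φ) = φ := fun φ => e.symm_apply_apply φ
  refine ⟨e.symm, fun u => ?_, e.symm.strictMono, ?_, hsymm _, ?_⟩
  · have := HasDerivAt.of_local_left_inverse (f := ellipticF m) (g := e.symm) (a := u)
      e.symm.continuous.continuousAt (hasDerivAt_ellipticF hm _)
      (inv_pos.2 (sqrt_pos.2 (one_sub_mul_sin_sq_pos hm _))).ne'
      (Eventually.of_forall e.apply_symm_apply)
    rwa [inv_inv] at this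
  · simpa [ellipticF] using hsymm 0
  · exact (congrArg e.symm (ellipticF_neg m (π / 2)).symm).trans (hsymm _)

/-! ### Uniqueness for autonomous equations -/

/-- Two global solutions of an autonomous equation with a `C¹` vector field coincide as soon as
they agree at one time. Over a bounded time interval both stay in a compact set, on which the field
is Lipschitz. -/
theorem eq_of_hasDerivAt_of_contDiff {E : Type*} [NormedAddCommGroup E] [NormedSpace ℝ E]
    {v : E → E} (hv : ContDiff ℝ 1 v) {f g : ℝ → E} (hf : ∀ t, HasDerivAt f (v (f t)) t)
    (hg : ∀ t, HasDerivAt g (v (g t)) t) {t₀ : ℝ} (h : f t₀ = g t₀) : f = g := by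
  ext t
  obtain ⟨a, b, ht, ht₀⟩ : ∃ a b, t ∈ Ioo a b ∧ t₀ ∈ Ioo a b :=
    ⟨min t t₀ - 1, max t t₀ + 1, by grind⟩
  have hfc : Continuous f := continuous_iff_continuousAt.2 fun t => (hf t).continuousAt
  have hgc : Continuous g := continuous_iff_continuousAt.2 fun t => (hg t).continuousAt
  obtain ⟨K, hK⟩ := (hv.locallyLipschitz.locallyLipschitzOn
    (s := f '' Icc a b ∪ g '' Icc a b)).exists_lipschitzOnWith_of_compact
    ((isCompact_Icc.image hfc).union (isCompact_Icc.image hgc))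
  exact ODE_solution_unique_of_mem_Ioo (v := fun _ => v) (fun _ _ => hK) ht₀
    (fun t ht => ⟨hf t, .inl ⟨t, Ioo_subset_Icc_self ht, rfl⟩⟩)
    (fun t ht => ⟨hg t, .inr ⟨t, Ioo_subset_Icc_self ht, rfl⟩⟩) h ht

/-! ### The explicit orbit -/

/-- The parameter `m = k²` of the orbit through `(1, 0, 0)`. Here `c` and `-β` are the
roots of `γ - 2 ρ̂ y - (γ - δ) y²`, so that `c` is the largest value of the second coordinate
of `L / l`. The value is not positive when `β ≤ 1`. -/
noncomputable def orbitModulus (c β : ℝ) : ℝ := c ^ 2 * (β ^ 2 - 1) / (β ^ 2 - c ^ 2)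

/-- The orbit through `(1, 0, 0)` on the unit sphere, parametrised by the Jacobi
amplitude `φ`; the parameters `c`, `β` are as in `orbitModulus`. -/
noncomputable def rotorOrbit (c β φ : ℝ) : Fin 3 → ℝ :=
  ![(β + c) * cos φ / (β + c * cos φ ^ 2),
    c * β * sin φ ^ 2 / (β + c * cos φ ^ 2),
    -(√(β ^ 2 - c ^ 2) * sin φ * √(1 - orbitModulus c β * sin φ ^ 2)) / (β + c * cos φ ^ 2)]

section Orbit

variable {c β : ℝ}

theorem orbitModulus_mul (hc : 0 < c) (hcβ : c < β) :
    orbitModulus c β * (β ^ 2 - c ^ 2) = c ^ 2 * (β ^ 2 - 1) :=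
  div_mul_cancel₀ _ (by nlinarith)

theorem orbitModulus_lt_one (hc : 0 < c) (hcβ : c < β) (hc₁ : c < 1) : orbitModulus c β < 1 := by
  rw [orbitModulus, div_lt_one (by nlinarith)]
  nlinarith [mul_pos (pow_pos (hc.trans hcβ) 2) (show 0 < 1 - c ^ 2 by nlinarith)]

theorem rotorOrbit_denom_pos (hc : 0 < c) (hcβ : c < β) (φ : ℝ) : 0 < β + c * cos φ ^ 2 := by
  have := hc.trans hcβ
  positivity

theorem rotorOrbit_two_sq (hc : 0 < c) (hcβ : c < β) (hc₁ : c < 1) (φ : ℝ) :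
    rotorOrbit c β φ 2 ^ 2 =
      ((β ^ 2 - c ^ 2) - c ^ 2 * (β ^ 2 - 1) * sin φ ^ 2) * sin φ ^ 2 /
        (β + c * cos φ ^ 2) ^ 2 := by
  have hN : √(β ^ 2 - c ^ 2) ^ 2 = β ^ 2 - c ^ 2 := sq_sqrt (by nlinarith)
  have hd := sq_sqrt (one_sub_mul_sin_sq_pos (orbitModulus_lt_one hc hcβ hc₁) φ).le
  simp only [rotorOrbit, Matrix.cons_val, div_pow, neg_sq, mul_pow, hN, hd]
  congr 1
  linear_combination (-sin φ ^ 4) * orbitModulus_mul hc hcβ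

/-- The orbit lies on the unit sphere: conservation of the norm of the angular momentum. -/
theorem rotorOrbit_norm_sq (hc : 0 < c) (hcβ : c < β) (hc₁ : c < 1) (φ : ℝ) :
    rotorOrbit c β φ 0 ^ 2 + rotorOrbit c β φ 1 ^ 2 + rotorOrbit c β φ 2 ^ 2 = 1 := by
  have hD := (rotorOrbit_denom_pos hc hcβ φ).ne'
  rw [rotorOrbit_two_sq hc hcβ hc₁]
  simp only [rotorOrbit, Matrix.cons_val, sin_sq]
  field_simp
  ring

/-- Conservation of the energy along the orbit. -/
theorem rotorOrbit_energy (hc : 0 < c) (hcβ : c < β) (hc₁ : c < 1) (φ : ℝ) :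
    c * β * rotorOrbit c β φ 2 ^ 2 =
      rotorOrbit c β φ 1 * ((β - c) + (1 - c * β) * rotorOrbit c β φ 1) := by
  have hD := (rotorOrbit_denom_pos hc hcβ φ).ne'
  rw [rotorOrbit_two_sq hc hcβ hc₁]
  simp only [rotorOrbit, Matrix.cons_val, sin_sq]
  field_simp
  ring

theorem rotorOrbit_one_nonneg (hc : 0 < c) (hcβ : c < β) (φ : ℝ) : 0 ≤ rotorOrbit c β φ 1 := by
  have := rotorOrbit_denom_pos hc hcβ φ
  have := hc.trans hcβ
  simp only [rotorOrbit, Matrix.cons_val]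
  positivity

theorem sub_rotorOrbit_one (hc : 0 < c) (hcβ : c < β) (φ : ℝ) :
    c - rotorOrbit c β φ 1 = c * (β + c) * cos φ ^ 2 / (β + c * cos φ ^ 2) := by
  have hD := (rotorOrbit_denom_pos hc hcβ φ).ne'
  simp only [rotorOrbit, Matrix.cons_val, sin_sq]
  field_simp
  ring

theorem rotorOrbit_one_le (hc : 0 < c) (hcβ : c < β) (φ : ℝ) : rotorOrbit c β φ 1 ≤ c := by
  have := rotorOrbit_denom_pos hc hcβ φ
  have := hc.trans hcβ
  rw [← sub_nonneg, sub_rotorOrbit_one hc hcβ]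
  positivity

/-- The energy relation compared with its value at `![0, c, √(1 - c ^ 2)]`; the right-hand side is
nonnegative and vanishes only where the second coordinate is `c`. -/
theorem mul_one_sub_sq_sub_rotorOrbit_two_sq (hc : 0 < c) (hcβ : c < β) (hc₁ : c < 1) (φ : ℝ) :
    c * β * ((1 - c ^ 2) - rotorOrbit c β φ 2 ^ 2) =
      (c - rotorOrbit c β φ 1) * ((β - c) + (1 - c * β) * (c + rotorOrbit c β φ 1)) := by
  linear_combination -rotorOrbit_energy hc hcβ hc₁ φ

theorem rotorOrbit_two_le (hc : 0 < c) (hcβ : c < β) (hc₁ : c < 1) (hlt : c * β < 1) (φ : ℝ) :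
    rotorOrbit c β φ 2 ≤ √(1 - c ^ 2) := by
  have h := mul_one_sub_sq_sub_rotorOrbit_two_sq hc hcβ hc₁ φ
  have h₁ : 0 ≤ (β - c) + (1 - c * β) * (c + rotorOrbit c β φ 1) :=
    add_nonneg (by linarith)
      (mul_nonneg (by linarith) (add_nonneg hc.le (rotorOrbit_one_nonneg hc hcβ φ)))
  have h₂ := mul_nonneg (sub_nonneg.2 (rotorOrbit_one_le hc hcβ φ)) h₁
  rw [← h] at h₂
  exact le_sqrt_of_sq_le
    (sub_nonneg.1 (nonneg_of_mul_nonneg_right h₂ (mul_pos hc (hc.trans hcβ))))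

/-- The highest point is the only one at its height: there the energy relation forces the second
coordinate to be `c`, which happens only where the first one vanishes. -/
theorem rotorOrbit_eq_of_two_eq (hc : 0 < c) (hcβ : c < β) (hc₁ : c < 1) (hlt : c * β < 1) {φ : ℝ}
    (h2 : rotorOrbit c β φ 2 = √(1 - c ^ 2)) : rotorOrbit c β φ = ![0, c, √(1 - c ^ 2)] := by
  have h := mul_one_sub_sq_sub_rotorOrbit_two_sq hc hcβ hc₁ φ
  have h₁ : 0 < (β - c) + (1 - c * β) * (c + rotorOrbit c β φ 1) :=
    add_pos_of_pos_of_nonneg (by linarith)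
      (mul_nonneg (by linarith) (add_nonneg hc.le (rotorOrbit_one_nonneg hc hcβ φ)))
  rw [h2, sq_sqrt (by nlinarith), sub_self, mul_zero, eq_comm, mul_eq_zero_iff_right h₁.ne'] at h
  have hx1 : rotorOrbit c β φ 1 = c := by linarith
  have hx0 : rotorOrbit c β φ 0 ^ 2 = 0 := by
    have := rotorOrbit_norm_sq hc hcβ hc₁ φ
    rw [hx1, h2, sq_sqrt (by nlinarith)] at this
    linarith
  ext i
  fin_cases i
  · simpa using hx0
  · simpa using hx1
  · simpa using h2

theorem rotorOrbit_zero (hc : 0 < c) (hcβ : c < β) : rotorOrbit c β 0 = ![1, 0, 0] := by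
  have : β + c ≠ 0 := by linarith
  simp [rotorOrbit, this]

theorem rotorOrbit_neg_pi_div_two (hc : 0 < c) (hcβ : c < β) (hc₁ : c < 1) :
    rotorOrbit c β (-(π / 2)) = ![0, c, √(1 - c ^ 2)] := by
  have hβ : 0 < β := hc.trans hcβ
  have h := rotorOrbit_two_sq hc hcβ hc₁ (-(π / 2))
  have h0 : 0 ≤ rotorOrbit c β (-(π / 2)) 2 := by
    simp [rotorOrbit]
    positivity
  have h2 : rotorOrbit c β (-(π / 2)) 2 = √(1 - c ^ 2) := by
    rw [eq_comm, sqrt_eq_iff_eq_sq (by nlinarith) h0, h]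
    simp
    field_simp
    ring
  ext i
  fin_cases i
  · simp [rotorOrbit]
  · simp [rotorOrbit, hβ.ne']
  · simpa using h2

theorem rotorOrbit_pi_div_two (hc : 0 < c) (hcβ : c < β) (hc₁ : c < 1) :
    rotorOrbit c β (π / 2) = ![0, c, -√(1 - c ^ 2)] := by
  have h := rotorOrbit_neg_pi_div_two hc hcβ hc₁
  ext i
  have hi := congrFun h i
  fin_cases i
  · simp [rotorOrbit]
  · simpa [rotorOrbit] using hi
  · simp [rotorOrbit] at hi ⊢
    rw [← hi]
    ring

theorem rotorOrbit_zero_pos (hc : 0 < c) (hcβ : c < β) {φ : ℝ}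
    (hφ : φ ∈ Ioo (-(π / 2)) (π / 2)) : 0 < rotorOrbit c β φ 0 := by
  have := cos_pos_of_mem_Ioo hφ
  have := rotorOrbit_denom_pos hc hcβ φ
  have := hc.trans hcβ
  simp only [rotorOrbit, Matrix.cons_val]
  positivity

theorem rotorOrbit_one_pos (hc : 0 < c) (hcβ : c < β) {φ : ℝ} (hφ : sin φ ≠ 0) :
    0 < rotorOrbit c β φ 1 := by
  have := rotorOrbit_denom_pos hc hcβ φ
  have := hc.trans hcβ
  simp only [rotorOrbit, Matrix.cons_val]
  positivity

theorem rotorOrbit_two_neg (hc : 0 < c) (hcβ : c < β) (hc₁ : c < 1) {φ : ℝ} (hφ : 0 < sin φ) :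
    rotorOrbit c β φ 2 < 0 := by
  have := rotorOrbit_denom_pos hc hcβ φ
  have := sqrt_pos.2 (one_sub_mul_sin_sq_pos (orbitModulus_lt_one hc hcβ hc₁) φ)
  have := sqrt_pos.2 (show 0 < β ^ 2 - c ^ 2 by nlinarith)
  simp only [rotorOrbit, Matrix.cons_val]
  rw [neg_div, neg_lt_zero]
  positivity

theorem rotorOrbit_two_neg_arg (φ : ℝ) : rotorOrbit c β (-φ) 2 = -rotorOrbit c β φ 2 := by
  simp [rotorOrbit]
  ring

/-- The derivative `dn' = -κ m sn cn` of Jacobi's delta amplitude. -/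
theorem hasDerivAt_sqrt_one_sub_mul_sin_sq {m κ : ℝ} {φ : ℝ → ℝ} {t : ℝ} (hm : m < 1)
    (hφ : HasDerivAt φ (κ * √(1 - m * sin (φ t) ^ 2)) t) :
    HasDerivAt (fun t => √(1 - m * sin (φ t) ^ 2)) (-(κ * (m * sin (φ t) * cos (φ t)))) t := by
  have hpos := one_sub_mul_sin_sq_pos hm (φ t)
  have hd := (sqrt_pos.2 hpos).ne'
  refine ((((hφ.sin.pow 2).const_mul m).const_sub 1).sqrt hpos.ne').congr_deriv ?_
  simp only [Pi.pow_apply]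
  field_simp
  ring

/-- If the amplitude grows at the rate `κ √(1 - m sin² φ)` of Jacobi's elliptic functions, then
`l • rotorOrbit c β φ` moves along the rotor-on flow. The hypotheses on the moments of inertia and
the rotor say that `γ = g c β`, `δ = g (c β - 1)` and `ρ̂ = g (β - c) / 2`. -/
theorem isRotorOnMotion_rotorOrbit (B : RotorBody) (hc : 0 < c) (hcβ : c < β) (hc₁ : c < 1)
    (hI₁ : B.I₁ ≠ 0) {g : ℝ} (hI₃ : B.I₃⁻¹ = (1 + g * c * β) / B.I₁)
    (hI₂ : B.I₂⁻¹ = (1 + g * (c * β - 1)) / B.I₁)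
    (hh : B.h * (1 + g * (c * β - 1)) = B.l * g * (β - c) / 2) {φ : ℝ → ℝ}
    (hφ : ∀ t, HasDerivAt φ (B.l * g * √(β ^ 2 - c ^ 2) / (2 * B.I₁) *
      √(1 - orbitModulus c β * sin (φ t) ^ 2)) t) :
    B.IsRotorOnMotion fun t => B.l • rotorOrbit c β (φ t) := by
  intro t
  have hm₁ := orbitModulus_lt_one hc hcβ hc₁
  have hN : √(β ^ 2 - c ^ 2) ^ 2 = β ^ 2 - c ^ 2 := sq_sqrt (by nlinarith)
  have hm := orbitModulus_mul hc hcβ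
  have hD := (rotorOrbit_denom_pos hc hcβ (φ t)).ne'
  have hs := sin_sq (φ t)
  have hd := sq_sqrt (one_sub_mul_sin_sq_pos hm₁ (φ t)).le
  have hsn := (hφ t).sin
  have hcn := (hφ t).cos
  have hdn := hasDerivAt_sqrt_one_sub_mul_sin_sq hm₁ (hφ t)
  have hDd := (hcn.pow 2).const_mul c |>.const_add β
  have h0 := ((hcn.const_mul (β + c)).div hDd hD).const_mul B.l
  have h1 := (((hsn.pow 2).const_mul (c * β)).div hDd hD).const_mul B.l
  have h2 := ((((hsn.const_mul √(β ^ 2 - c ^ 2)).mul hdn).neg).div hDd hD).const_mul B.l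
  have hΩ₂ : ∀ x, (x - B.h) / B.I₂ =
      (x * (1 + g * (c * β - 1)) - B.l * g * (β - c) / 2) / B.I₁ := fun x => by
    rw [← hh, div_eq_mul_inv, hI₂]
    ring
  have hΩ₃ : ∀ x, x / B.I₃ = x * (1 + g * c * β) / B.I₁ := fun x => by
    rw [div_eq_mul_inv, hI₃, mul_div_assoc]
  rw [hasDerivAt_pi]
  intro i
  fin_cases i <;>
    simp only [rotorOrbit, RotorBody.angularVelocity, cross_apply, Matrix.cons_val, Pi.smul_apply,
      smul_eq_mul, hΩ₂, hΩ₃, Fin.zero_eta, Fin.mk_one, Fin.reduceFinMk]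
  · refine h0.congr_deriv ?_
    simp only [Pi.pow_apply]
    clear h0 h1 h2 hsn hcn hdn hDd hφ hm₁
    generalize √(1 - orbitModulus c β * sin (φ t) ^ 2) = d at *
    generalize orbitModulus c β = m at *
    generalize √(β ^ 2 - c ^ 2) = N at *
    generalize sin (φ t) = s at *
    generalize cos (φ t) = C at *
    field_simp
    rw [hs]
    ring
  · refine h1.congr_deriv ?_
    simp only [Pi.pow_apply]
    clear h0 h1 h2 hsn hcn hdn hDd hφ hm₁
    generalize √(1 - orbitModulus c β * sin (φ t) ^ 2) = d at *
    generalize orbitModulus c β = m at *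
    generalize √(β ^ 2 - c ^ 2) = N at *
    generalize sin (φ t) = s at *
    generalize cos (φ t) = C at *
    field_simp
    push_cast
    linear_combination (2 * B.l ^ 2 * c ^ 2 * β * g * N * d * s * C) * hs
  · refine h2.congr_deriv ?_
    simp only [Pi.pow_apply, Pi.mul_apply, Pi.neg_apply]
    clear h0 h1 h2 hsn hcn hdn hDd hφ hm₁
    generalize √(1 - orbitModulus c β * sin (φ t) ^ 2) = d at *
    generalize orbitModulus c β = m at *
    generalize √(β ^ 2 - c ^ 2) = N at *
    generalize sin (φ t) = s at *
    generalize cos (φ t) = C at *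
    -- the third Euler equation, divided by `cos φ` and cleared of constants
    have key : N ^ 2 * ((d ^ 2 - m * s ^ 2) * (β + c * C ^ 2) + 2 * c * s ^ 2 * d ^ 2) =
        (β + c) * (2 * (1 - c * β) * (c * β) * s ^ 2 + (β - c) * (β + c * C ^ 2)) := by
      rw [hd, hs]
      linear_combination (β + c * C ^ 2 + 2 * c * (1 - C ^ 2)) * hN -
        (m * (1 - C ^ 2) * (2 * (β + c))) * hN - ((1 - C ^ 2) * (2 * (β + c))) * hm
    generalize β + c * C ^ 2 = D at *
    field_simp
    push_cast
    linear_combination (-B.l ^ 2 * C * g) * key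

/-! ### Orbit parameters and physical constants -/

/-- The parameters `c`, `β` in terms of the coefficients of the quadratic
`γ - 2 r y - (γ - δ) y²`, whose roots are `c` and `-β`. -/
theorem exists_orbit_parameters {γ δ r : ℝ} (hγ : 0 < γ) (hδ : δ < 0) (hr : 0 < r) :
    ∃ c β, 0 < c ∧ c < β ∧ c * β < 1 ∧ c < 1 ∧ γ = (γ - δ) * c * β ∧ 2 * r = (γ - δ) * (β - c) ∧
      -c = (r - √(r ^ 2 + γ * (γ - δ))) / (γ - δ) := by
  have hg : 0 < γ - δ := by linarith
  have hS2 : √(r ^ 2 + γ * (γ - δ)) ^ 2 = r ^ 2 + γ * (γ - δ) := sq_sqrt (by positivity)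
  have hS : r < √(r ^ 2 + γ * (γ - δ)) := lt_sqrt_of_sq_lt (by nlinarith [mul_pos hγ hg])
  generalize √(r ^ 2 + γ * (γ - δ)) = S at *
  have hc : 0 < (S - r) / (γ - δ) := div_pos (by linarith) hg
  have hcβ : (S - r) / (γ - δ) < (S + r) / (γ - δ) := by gcongr; linarith
  have hprod : γ = (γ - δ) * ((S - r) / (γ - δ)) * ((S + r) / (γ - δ)) := by
    field_simp
    linear_combination -hS2
  have hlt : (S - r) / (γ - δ) * ((S + r) / (γ - δ)) < 1 := by
    rw [mul_assoc] at hprod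
    -- otherwise `γ ≥ γ - δ`, against `δ < 0`
    by_contra! h
    nlinarith
  refine ⟨(S - r) / (γ - δ), (S + r) / (γ - δ), hc, hcβ, hlt, by nlinarith, hprod, ?_, ?_⟩
  · field_simp
    ring
  · ring

theorem kSquared_eq_orbitModulus (hc : 0 < c) (hcβ : c < β) {s ν : ℝ} (hs : s ^ 2 = 1 - c / β)
    (hν : ν = 1 - 1 / (c * β)) : kSquared s ν = orbitModulus c β := by
  have hβ : β ≠ 0 := (hc.trans hcβ).ne'
  have h₁ : β - c ≠ 0 := by linarith
  have h₂ : β + c ≠ 0 := by linarith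
  have h₃ : β ^ 2 - c ^ 2 ≠ 0 := by
    rw [sq_sub_sq]
    exact mul_ne_zero h₂ h₁
  have e₁ : (s ^ 2)⁻¹ - 1 = c / (β - c) := by
    rw [hs, show 1 - c / β = (β - c) / β by field_simp]
    field_simp
    ring
  have e₂ : s ^ 2 * (1 - ν) + ν = (β ^ 2 - 1) / β ^ 2 := by
    rw [hs, hν]
    field_simp
    ring
  have e₃ : (2 - s ^ 2) * (1 - ν) = (β + c) / (c * β ^ 2) := by
    rw [hs, hν]
    field_simp
    ring
  rw [kSquared, orbitModulus, e₁, e₂, e₃]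
  field_simp
  ring

/-- The factor of `K` in the time formula equals `γ l / (2 I₁ κ)`, where `γ = (γ - δ) c β` and
`κ = l (γ - δ) √(β² - c²) / (2 I₁)` is the rate of the amplitude. -/
theorem sqrt_timeFactor_eq (hc : 0 < c) (hcβ : c < β) {s ν : ℝ} (hs : s ^ 2 = 1 - c / β)
    (hν : ν = 1 - 1 / (c * β)) :
    √((1 - s ^ 2) / (s ^ 2 * (2 - s ^ 2) * (1 - ν))) = c * β / √(β ^ 2 - c ^ 2) := by
  have hβ : 0 < β := hc.trans hcβ
  have h₁ : β - c ≠ 0 := by linarith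
  have h₂ : β + c ≠ 0 := by linarith
  have h₃ : β ^ 2 - c ^ 2 ≠ 0 := by
    rw [sq_sub_sq]
    exact mul_ne_zero h₂ h₁
  have e₁ : s ^ 2 * (2 - s ^ 2) * (1 - ν) = (β ^ 2 - c ^ 2) / (c * β ^ 3) := by
    rw [hs, hν]
    field_simp
    ring
  have e₂ : (1 - s ^ 2) / (s ^ 2 * (2 - s ^ 2) * (1 - ν)) =
      (c * β) ^ 2 / (β ^ 2 - c ^ 2) := by
    rw [e₁, hs]
    field_simp
    ring
  rw [e₂, sqrt_div' _ (by nlinarith), sqrt_sq (by positivity)]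

end Orbit

/-! ### The rotor-on flow -/

namespace RotorBody

theorem contDiff_vectorField (B : RotorBody) :
    ContDiff ℝ 1 fun L : Fin 3 → ℝ => L ⨯₃ B.angularVelocity L := by
  rw [contDiff_pi]
  intro i
  fin_cases i <;> simp only [angularVelocity, cross_apply, Matrix.cons_val, Fin.zero_eta,
    Fin.mk_one, Fin.reduceFinMk] <;> fun_prop

theorem energy_eq (B : RotorBody) (h₁ : B.I₁ ≠ 0) (h₂ : B.I₂ ≠ 0) (h₃ : B.I₃ ≠ 0)
    (L : Fin 3 → ℝ) :
    B.energy L = B.I₁ / B.l ^ 2 *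
      (1 / 2 * (L 0 ^ 2 / B.I₁ + (L 1 - B.h) ^ 2 / B.I₂ + L 2 ^ 2 / B.I₃)) := by
  have hinv : (Matrix.diagonal ![B.I₁, B.I₂, B.I₃])⁻¹ =
      Matrix.diagonal ![B.I₁⁻¹, B.I₂⁻¹, B.I₃⁻¹] := by
    refine Matrix.inv_eq_right_inv ?_
    rw [Matrix.diagonal_mul_diagonal, ← Matrix.diagonal_one]
    congr 1
    ext i
    fin_cases i <;> simp [h₁, h₂, h₃]
  rw [energy, hinv]
  simp [dotProduct, Fin.sum_univ_three, Matrix.mulVec_diagonal, Matrix.vecHead, Matrix.vecTail]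
  ring_nf
  simp

end RotorBody

theorem mainTheorem7 (B : RotorBody)
    (hI₃ : 0 < B.I₃) (hI₃₁ : B.I₃ < B.I₁) (hI₁₂ : B.I₁ < B.I₂)
    (hl : 0 < B.l) (hh : 0 < B.h)
    (L : ℝ → Fin 3 → ℝ) (hL : B.IsRotorOnMotion L) (hL0 : L 0 = ![B.l, 0, 0]) :
    -- the rotor-on energy
    (∀ t, B.energy (L t) = 1 / 2 * (1 + B.rho * B.rhoHat)) ∧
    ∃ θmax ∈ Set.Ioo 0 (Real.pi / 2), ∃ θtilde ∈ Set.Ioo (-(Real.pi / 2)) 0,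
    ∃ sPlus sMinus T₂ : ℝ,
      -- the highest point of the orbit
      (∃ t, L t = ![0, -(B.l * Real.sin θtilde), B.l * Real.cos θtilde]) ∧
      (∀ t, L t 2 ≤ B.l * Real.cos θtilde) ∧
      (∀ t, L t 2 = B.l * Real.cos θtilde →
        L t = ![0, -(B.l * Real.sin θtilde), B.l * Real.cos θtilde]) ∧
      IsGreatest (Set.range fun t => L t 2 / B.l) (Real.sin θmax) ∧
      -- the endpoint tilt
      sPlus = Real.sin θmax ∧
      -Real.sqrt (1 - sPlus ^ 2) = -Real.cos θmax ∧
      -Real.cos θmax = Real.sin θtilde ∧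
      Real.sin θtilde =
        (B.rhoHat - Real.sqrt (B.rhoHat ^ 2 + B.gamma * (B.gamma - B.delta))) /
          (B.gamma - B.delta) ∧
      -- the parameter `s₋`
      0 < sMinus ∧ sMinus < 1 ∧
      sPlus ^ 2 + (1 - sPlus ^ 2) * B.nu = sMinus ^ 2 ∧
      -- `T₂` is the time between `(l, 0, 0)` and the highest point along the orbit segment that
      -- joins them; it is also the time from `(l, 0, 0)` to the mirror image of the highest point
      0 < T₂ ∧
      L (-T₂) = ![0, -(B.l * Real.sin θtilde), B.l * Real.cos θtilde] ∧
      (∀ t ∈ Set.Ioo (-T₂) 0, 0 < L t 0 ∧ 0 < L t 1 ∧ 0 < L t 2) ∧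
      L T₂ = ![0, -(B.l * Real.sin θtilde), -(B.l * Real.cos θtilde)] ∧
      (∀ t ∈ Set.Ioo 0 T₂, 0 < L t 0 ∧ 0 < L t 1 ∧ L t 2 < 0) ∧
      -- the value of the scaled time `T̂₂ = l T₂ / I₁`
      kSquared sMinus B.nu < 1 ∧
      B.gamma * (B.l * T₂ / B.I₁) =
        2 * Real.sqrt ((1 - sMinus ^ 2) / (sMinus ^ 2 * (2 - sMinus ^ 2) * (1 - B.nu))) *
          ellipticK (kSquared sMinus B.nu) ∧
      (0 < sMinus ^ 2 * (1 - B.nu) + B.nu →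
        ∃ k, 0 < k ∧ k < 1 ∧ k ^ 2 = kSquared sMinus B.nu ∧
          B.gamma * (B.l * T₂ / B.I₁) =
            2 * k / Real.sqrt (sMinus ^ 2 * (1 - B.nu) + B.nu) * ellipticK (k ^ 2)) := by
  have hI₁ : 0 < B.I₁ := hI₃.trans hI₃₁
  have hI₂ : 0 < B.I₂ := hI₁.trans hI₁₂
  have hγ : 0 < B.gamma := sub_pos.2 ((one_lt_div hI₃).2 hI₃₁)
  have hδ : B.delta < 0 := sub_neg.2 ((div_lt_one hI₂).2 hI₁₂)
  have hr : 0 < B.rhoHat := by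
    simp only [RotorBody.rhoHat, RotorBody.rho, RotorBody.delta]
    rw [add_sub_cancel]
    positivity
  -- on the orbit, `c` is the second coordinate of the highest point of `L / l`
  obtain ⟨c, β, hc, hcβ, hlt, hc₁, hprod, hdiff, hcform⟩ := exists_orbit_parameters hγ hδ hr
  have hg : 0 < B.gamma - B.delta := by linarith
  have hβ : 0 < β := hc.trans hcβ
  have hsq : 0 < β ^ 2 - c ^ 2 := by nlinarith
  have hm₁ := orbitModulus_lt_one hc hcβ hc₁
  have hδ' : B.delta = (B.gamma - B.delta) * (c * β - 1) := by linear_combination hprod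
  have hν : B.nu = 1 - 1 / (c * β) := by
    rw [RotorBody.nu, div_eq_iff hγ.ne']
    field_simp
    linear_combination -(c * β - 1) * hprod + c * β * hδ'
  have hI₃' : B.I₃⁻¹ = (1 + B.gamma) / B.I₁ := by
    rw [RotorBody.gamma]
    field_simp
    ring
  have hI₂' : B.I₂⁻¹ = (1 + B.delta) / B.I₁ := by
    rw [RotorBody.delta]
    field_simp
    ring
  have hh' : B.h * (1 + B.delta) = B.l * B.rhoHat := by
    rw [RotorBody.rhoHat, RotorBody.rho]
    field_simp
  have hρ : B.rho * (1 + B.delta) = B.rhoHat := rfl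
  -- the amplitude as a function of `κ t`
  set κ : ℝ := B.l * (B.gamma - B.delta) * √(β ^ 2 - c ^ 2) / (2 * B.I₁) with hκ
  have hκpos : 0 < κ := by
    have := sqrt_pos.2 hsq
    positivity
  obtain ⟨am, ham, hmono, ham0, hamK, hamK'⟩ := exists_jacobi_amplitude hm₁
  have hφ : ∀ t, HasDerivAt (fun t => am (κ * t))
      (κ * √(1 - orbitModulus c β * sin (am (κ * t)) ^ 2)) t := fun t =>
    ((ham (κ * t)).comp t ((hasDerivAt_id t).const_mul κ)).congr_deriv (by ring)
  have hmotion := isRotorOnMotion_rotorOrbit B hc hcβ hc₁ hI₁.ne' (g := B.gamma - B.delta)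
    (by rw [hI₃', ← hprod]) (by rw [hI₂', ← hδ'])
    (by rw [← hδ', hh']; linear_combination B.l / 2 * hdiff) hφ
  have hLX : L = fun t => B.l • rotorOrbit c β (am (κ * t)) :=
    eq_of_hasDerivAt_of_contDiff B.contDiff_vectorField hL hmotion (t₀ := 0) (by
      rw [hL0, mul_zero, ham0, rotorOrbit_zero hc hcβ]
      ext i
      fin_cases i <;> simp)
  subst hLX
  have hK := ellipticK_pos hm₁
  set T : ℝ := ellipticK (orbitModulus c β) / κ with hT
  have hTpos : 0 < T := div_pos hK hκpos
  have hκT : κ * T = ellipticK (orbitModulus c β) := mul_div_cancel₀ _ hκpos.ne'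
  have hφT : am (κ * T) = π / 2 := by rw [hκT, hamK]
  have hφT' : am (κ * -T) = -(π / 2) := by rw [mul_neg, hκT, hamK']
  have hφpos : ∀ t ∈ Ioo 0 T, am (κ * t) ∈ Ioo 0 (π / 2) := fun t ht => by
    rw [← ham0, ← hφT]
    exact ⟨hmono (mul_pos hκpos ht.1), hmono (by gcongr; exact ht.2)⟩
  have hφneg : ∀ t ∈ Ioo (-T) 0, am (κ * t) ∈ Ioo (-(π / 2)) 0 := fun t ht => by
    rw [← ham0, ← hφT']
    exact ⟨hmono (by gcongr; exact ht.1), hmono (mul_neg_of_pos_of_neg hκpos ht.2)⟩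
  have hs₁ : sin (-arcsin c) = -c := by rw [sin_neg, sin_arcsin (by linarith) hc₁.le]
  have hcos₁ : cos (-arcsin c) = √(1 - c ^ 2) := by rw [cos_neg, cos_arcsin]
  have hs₂ : sin (arccos c) = √(1 - c ^ 2) := sin_arccos c
  have hcos₂ : cos (arccos c) = c := cos_arccos (by linarith) hc₁.le
  have hc2 : √(1 - c ^ 2) ^ 2 = 1 - c ^ 2 := sq_sqrt (by nlinarith)
  have htop : B.l • ![0, c, √(1 - c ^ 2)] = ![0, -(B.l * -c), B.l * √(1 - c ^ 2)] := by
    ext i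
    fin_cases i <;> simp
  have hbot : B.l • ![0, c, -√(1 - c ^ 2)] = ![0, -(B.l * -c), -(B.l * √(1 - c ^ 2))] := by
    ext i
    fin_cases i <;> simp
  have hhigh : B.l • rotorOrbit c β (am (κ * -T)) = ![0, -(B.l * -c), B.l * √(1 - c ^ 2)] := by
    rw [hφT', rotorOrbit_neg_pi_div_two hc hcβ hc₁, htop]
  have hq : 0 < 1 - c / β := sub_pos.2 ((div_lt_one hβ).2 hcβ)
  have hs2 : √(1 - c / β) ^ 2 = 1 - c / β := sq_sqrt hq.le
  have hk := kSquared_eq_orbitModulus hc hcβ hs2 hν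
  have hfac := sqrt_timeFactor_eq hc hcβ hs2 hν
  have htime : B.gamma * (B.l * T / B.I₁) =
      2 * (c * β / √(β ^ 2 - c ^ 2)) * ellipticK (orbitModulus c β) := by
    have hN := (sqrt_pos.2 hsq).ne'
    have hg' := hg.ne'
    rw [hT, hκ]
    field_simp
    linear_combination hprod
  refine ⟨fun t => ?_, arccos c, ⟨arccos_pos.2 hc₁, arccos_lt_pi_div_two.2 hc⟩, -arcsin c,
    ⟨neg_lt_neg (arcsin_lt_pi_div_two.2 hc₁), neg_lt_zero.2 (arcsin_pos.2 hc)⟩,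
    √(1 - c ^ 2), √(1 - c / β), T, ?_⟩
  · rw [B.energy_eq hI₁.ne' hI₂.ne' hI₃.ne', div_eq_mul_inv _ B.I₂, div_eq_mul_inv _ B.I₃, hI₂',
      hI₃']
    have h₁ := rotorOrbit_norm_sq hc hcβ hc₁ (am (κ * t))
    have h₂ := rotorOrbit_energy hc hcβ hc₁ (am (κ * t))
    have hhρ : B.h = B.l * B.rho := by
      rw [RotorBody.rho]
      field_simp
    simp only [Pi.smul_apply, smul_eq_mul, hhρ]
    generalize rotorOrbit c β (am (κ * t)) = x at *
    have hcons : B.gamma * x 2 ^ 2 = x 1 * (2 * B.rhoHat - B.delta * x 1) := by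
      linear_combination x 2 ^ 2 * hprod + (B.gamma - B.delta) * h₂ - x 1 * hdiff + x 1 ^ 2 * hδ'
    trans 1 / 2 * (x 0 ^ 2 + (1 + B.delta) * (x 1 - B.rho) ^ 2 + (1 + B.gamma) * x 2 ^ 2)
    · field_simp
    · linear_combination 1 / 2 * h₁ + 1 / 2 * hcons + (B.rho / 2 - x 1) * hρ
  rw [hs₁, hcos₁, hs₂, hcos₂, hc2, hk, hfac, hs2]
  refine ⟨⟨-T, hhigh⟩, fun t => ?_, fun t ht => ?_, ⟨⟨-T, ?_⟩, ?_⟩, rfl, ?_, rfl, hcform,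
    sqrt_pos.2 hq, ?_, ?_, hTpos, hhigh, fun t ht => ?_, ?_, fun t ht => ?_, hm₁, htime,
    fun hpos => ?_⟩
  · exact mul_le_mul_of_nonneg_left (rotorOrbit_two_le hc hcβ hc₁ hlt _) hl.le
  · rw [← htop, ← rotorOrbit_eq_of_two_eq hc hcβ hc₁ hlt (mul_left_cancel₀ hl.ne' ht)]
  · dsimp only
    rw [hhigh]
    simp [hl.ne']
  · rintro _ ⟨t, rfl⟩
    simpa [hl.ne'] using rotorOrbit_two_le hc hcβ hc₁ hlt (am (κ * t))
  · rw [sub_sub_cancel, sqrt_sq hc.le]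
  · rw [sqrt_lt' one_pos]
    have := div_pos hc hβ
    linarith
  · rw [hν]
    field_simp
    ring
  · have hφt := hφneg t ht
    have hsin : sin (am (κ * t)) < 0 :=
      sin_neg_of_neg_of_neg_pi_lt hφt.2 (by linarith [hφt.1, pi_pos])
    have h2 := rotorOrbit_two_neg hc hcβ hc₁ (φ := -am (κ * t)) (by rw [sin_neg]; linarith)
    rw [rotorOrbit_two_neg_arg, neg_lt_zero] at h2
    exact ⟨mul_pos hl (rotorOrbit_zero_pos hc hcβ ⟨hφt.1, by linarith [hφt.2, pi_pos]⟩),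
      mul_pos hl (rotorOrbit_one_pos hc hcβ hsin.ne), mul_pos hl h2⟩
  · dsimp only
    rw [hφT, rotorOrbit_pi_div_two hc hcβ hc₁, hbot]
  · have hφt := hφpos t ht
    have hsin : 0 < sin (am (κ * t)) := sin_pos_of_pos_of_lt_pi hφt.1 (by linarith [hφt.2, pi_pos])
    exact ⟨mul_pos hl (rotorOrbit_zero_pos hc hcβ ⟨by linarith [hφt.1, pi_pos], hφt.2⟩),
      mul_pos hl (rotorOrbit_one_pos hc hcβ hsin.ne'),
      mul_neg_of_pos_of_neg hl (rotorOrbit_two_neg hc hcβ hc₁ hsin)⟩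
  · have hq' : (1 - c / β) * (1 - B.nu) + B.nu = (β ^ 2 - 1) / β ^ 2 := by
      rw [hν]
      field_simp
      ring
    rw [hq'] at hpos ⊢
    have hβ1 : 0 < β ^ 2 - 1 := by
      have := mul_pos hpos (pow_pos hβ 2)
      rwa [div_mul_cancel₀ _ (by positivity)] at this
    have hmpos : 0 < orbitModulus c β := by
      rw [orbitModulus]
      positivity
    have hmsqrt : √(orbitModulus c β) =
        c * √(β ^ 2 - 1) / √(β ^ 2 - c ^ 2) := by
      rw [orbitModulus, sqrt_div' _ hsq.le, sqrt_mul (by positivity), sqrt_sq hc.le]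
    refine ⟨√(orbitModulus c β), sqrt_pos.2 hmpos, ?_, sq_sqrt hmpos.le, ?_⟩
    · rw [sqrt_lt' one_pos]
      simpa using hm₁
    · rw [sq_sqrt hmpos.le, htime, hmsqrt, sqrt_div' _ (by positivity), sqrt_sq hβ.le]
      have := (sqrt_pos.2 hβ1).ne'
      have := (sqrt_pos.2 hsq).ne'
      field_simp
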